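/- Let $k\ge 2$ be an integer, let $C>1$ be real, and let $R\ge k$ be real. On a probability space, let $\mathbf{x}_n=(x_{1,n},\dots,x_{k,n})$, $n=1,2,3,\dots$, be independent random vectors, where $\mathbf{x}_n$ is uniformly distributed on the finite set of integer vectors in $[1,C^n]^k$. For a positive integer $a$ let $\Omega(a)$ denote the number of prime factors of $a$ counted with multiplicity. Define the random variable $$\mathfrak{n}=\max\{n\ge 1:\ \Omega(x_{1,n}x_{2,n}\cdots x_{k,n})\le R\}\in\{0,1,2,\dots\}\cup\{\infty\},$$ with $\mathfrak{n}=0$ if there is no such $n$, and $\mathfrak{n}=\infty$ if there are infinitely many such $n$. Then: 1. with probability one, $\mathfrak{n}<\infty$; and 2. for every real $m\ge k-1$, the $m$-th moment of $\mathfrak{n}$ is infinite: $\mathbb{E}[\mathfrak{n}^m]=\infty$. -/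

import Mathlib

open MeasureTheory ProbabilityTheory
open scoped ENNReal

/-- The integer vectors in the box `[1, C ^ n] ^ k`. -/
def drawBox (k : ℕ) (C : ℝ) (n : ℕ+) : Set (Fin k → ℕ) :=
  {v | ∀ j, 1 ≤ v j ∧ (v j : ℝ) ≤ C ^ (n : ℕ)}

/-- The indices `n ≥ 1` at which the product of the entries of `x n` is `R`-almost prime, that is,
has at most `R` prime factors counted with multiplicity. -/
def almostPrimeIndices {k : ℕ} (R : ℝ) (x : ℕ+ → Fin k → ℕ) : Set ℕ+ :=
  {n | (ArithmeticFunction.cardFactors (∏ j, x n j) : ℝ) ≤ R}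

/-- The largest index `n` at which the product of the entries of `x n` is `R`-almost prime.
The supremum is taken in `ℕ∞`, so it is `0` if there is no such index, and `⊤` if there are
infinitely many. -/
noncomputable def lastAlmostPrimeIndex {k : ℕ} (R : ℝ) (x : ℕ+ → Fin k → ℕ) : ℕ∞ :=
  ⨆ n ∈ almostPrimeIndices R x, ((n : ℕ) : ℕ∞)

/-! Let `A n` be the event that the product is `R`-almost prime at a given index, and put `r =
⌊R⌋₊`. Each entry is then itself `r`-almost prime. Chebyshev's bound on `ψ` and a dyadic bound for
`∑ 1/p` give such integers density `O(n ^ (-3/4))` up to `C ^ n`. Since `k ≥ 2`, the probabilities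
of the `A n` are summable, and Borel–Cantelli makes the last index almost surely finite.

Conversely, `k` prime entries suffice because `k ≤ R`, so the probability is at least a constant
times `n ^ (-k)`. By independence and summability, for large `n` at least half of `A n` consists of
outcomes with no later success. Hence the moment of order `k - 1` dominates a multiple of the
harmonic series (`lintegral_eq_top_of_tsum_mul_measure_eq_top`). -/

/-! ### Upper bounds for counts of almost primes -/

/-- The positive integers up to `N` with at most `r` prime factors, counted with multiplicity. -/
def almostPrimesUpTo (r N : ℕ) : Finset ℕ :=
  {a ∈ Finset.Icc 1 N | ArithmeticFunction.cardFactors a ≤ r}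

lemma mem_almostPrimesUpTo {r N a : ℕ} :
    a ∈ almostPrimesUpTo r N ↔ (1 ≤ a ∧ a ≤ N) ∧ ArithmeticFunction.cardFactors a ≤ r := by
  simp [almostPrimesUpTo]

lemma almostPrimesUpTo_mono {r M N : ℕ} (h : M ≤ N) :
    almostPrimesUpTo r M ⊆ almostPrimesUpTo r N := by
  intro a ha
  rw [mem_almostPrimesUpTo] at ha ⊢
  exact ⟨⟨ha.1.1, ha.1.2.trans h⟩, ha.2⟩

/-- Split off the smallest prime factor. -/
lemma almostPrimesUpTo_succ_subset (r N : ℕ) :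
    almostPrimesUpTo (r + 1) N ⊆ almostPrimesUpTo r N ∪
      (N.primesLE ×ˢ almostPrimesUpTo r N).image fun q => q.1 * q.2 := by
  intro a ha
  rw [mem_almostPrimesUpTo] at ha
  obtain ⟨⟨h1, hN⟩, hr⟩ := ha
  rw [Finset.mem_union]
  rcases eq_or_ne a 1 with rfl | hne
  · left
    simp [mem_almostPrimesUpTo, hN]
  right
  have hp := Nat.minFac_prime hne
  obtain ⟨b, hb⟩ := Nat.minFac_dvd a
  have hb0 : b ≠ 0 := by
    rintro rfl
    omega
  have hΩ : ArithmeticFunction.cardFactors a = 1 + ArithmeticFunction.cardFactors b := by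
    conv_lhs => rw [hb]
    rw [ArithmeticFunction.cardFactors_mul hp.ne_zero hb0,
      ArithmeticFunction.cardFactors_apply_prime hp]
  have hba : b ≤ a := Nat.le_of_dvd h1 ⟨a.minFac, by rw [mul_comm]; exact hb⟩
  refine Finset.mem_image.2 ⟨(a.minFac, b), Finset.mem_product.2 ⟨?_, ?_⟩, hb.symm⟩
  · rw [Nat.mem_primesLE]
    exact ⟨(Nat.minFac_le h1).trans hN, hp⟩
  · rw [mem_almostPrimesUpTo]
    exact ⟨⟨Nat.pos_of_ne_zero hb0, hba.trans hN⟩, by dsimp only; omega⟩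

/-- Each prime split off costs one factor `1 + ∑ 1/p`. -/
lemma sum_inv_almostPrimesUpTo_le (r N : ℕ) :
    ∑ a ∈ almostPrimesUpTo r N, (a : ℝ)⁻¹ ≤ (1 + ∑ p ∈ N.primesLE, (p : ℝ)⁻¹) ^ r := by
  induction r with
  | zero =>
    have : almostPrimesUpTo 0 N ⊆ {1} := by
      intro a ha
      simp only [mem_almostPrimesUpTo, nonpos_iff_eq_zero,
        ArithmeticFunction.cardFactors_eq_zero_iff_eq_zero_or_one] at ha
      rw [Finset.mem_singleton]
      omega
    calc _ ≤ ∑ a ∈ ({1} : Finset ℕ), (a : ℝ)⁻¹ :=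
          Finset.sum_le_sum_of_subset_of_nonneg this fun _ _ _ => by positivity
      _ = _ := by simp
  | succ r ih =>
    set P := ∑ p ∈ N.primesLE, (p : ℝ)⁻¹ with hP
    have hP0 : 0 ≤ P := Finset.sum_nonneg fun _ _ => by positivity
    calc ∑ a ∈ almostPrimesUpTo (r + 1) N, (a : ℝ)⁻¹
        ≤ ∑ a ∈ almostPrimesUpTo r N ∪
            (N.primesLE ×ˢ almostPrimesUpTo r N).image (fun q => q.1 * q.2), ((a : ℕ) : ℝ)⁻¹ :=
          Finset.sum_le_sum_of_subset_of_nonneg (almostPrimesUpTo_succ_subset r N)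
            fun _ _ _ => by positivity
      _ ≤ ∑ a ∈ almostPrimesUpTo r N, (a : ℝ)⁻¹ +
            ∑ a ∈ (N.primesLE ×ˢ almostPrimesUpTo r N).image (fun q => q.1 * q.2), ((a : ℕ) : ℝ)⁻¹ := by
          rw [← Finset.sum_union_inter]
          exact le_add_of_nonneg_right (Finset.sum_nonneg fun _ _ => by positivity)
      _ ≤ ∑ a ∈ almostPrimesUpTo r N, (a : ℝ)⁻¹ +
            ∑ q ∈ N.primesLE ×ˢ almostPrimesUpTo r N, ((q.1 * q.2 : ℕ) : ℝ)⁻¹ := by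
          gcongr
          exact Finset.sum_image_le_of_nonneg fun _ _ => by positivity
      _ = (1 + P) * ∑ a ∈ almostPrimesUpTo r N, (a : ℝ)⁻¹ := by
          rw [Finset.sum_product, hP, add_mul, one_mul, Finset.sum_mul_sum]
          simp [mul_comm]
      _ ≤ (1 + P) * (1 + P) ^ r := by gcongr
      _ = _ := (pow_succ' _ _).symm

/-- Chebyshev's upper bound, weighted by `log`: the number of almost primes up to `N` is controlled
by the sum of their reciprocals. -/
lemma card_almostPrimesUpTo_mul_log_le (r N : ℕ) :
    (almostPrimesUpTo r N).card * Real.log N ≤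
      (Real.log 4 + 5) * N * ∑ a ∈ almostPrimesUpTo r N, (a : ℝ)⁻¹ := by
  set A := almostPrimesUpTo r N with hA
  -- Write `log a` as the sum of `Λ d` over `a = d * b`, then sum over `b` first: the cofactor `b`
  -- is again in `A`, and `d ≤ N / b`.
  have hlog : ∑ a ∈ A, Real.log a ≤ ∑ b ∈ A, Chebyshev.psi (N / b : ℕ) := by
    have h1 : ∀ a : ℕ, Real.log a =
        ∑ q ∈ a.divisorsAntidiagonal, ArithmeticFunction.vonMangoldt q.1 := by
      intro a
      rw [← ArithmeticFunction.vonMangoldt_sum,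
        Nat.sum_divisorsAntidiagonal (fun d _ => ArithmeticFunction.vonMangoldt d)]
    simp only [h1, Chebyshev.psi, Nat.floor_natCast]
    rw [Finset.sum_sigma', Finset.sum_sigma']
    let e : (_ : ℕ) × (ℕ × ℕ) → (_ : ℕ) × ℕ := fun x => ⟨x.2.2, x.2.1⟩
    have he : Set.InjOn e (A.sigma fun a => a.divisorsAntidiagonal) := by
      rintro ⟨a, d, b⟩ h ⟨a', d', b'⟩ h' hxy
      simp only [Finset.coe_sigma, Set.mem_sigma_iff, Finset.mem_coe,
        Nat.mem_divisorsAntidiagonal] at h h'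
      simp only [e, Sigma.mk.injEq, heq_eq_eq] at hxy
      obtain ⟨rfl, rfl⟩ := hxy
      obtain rfl : a = a' := h.2.1.symm.trans h'.2.1
      rfl
    rw [← Finset.sum_image (g := e) (f := fun y => ArithmeticFunction.vonMangoldt y.2) he]
    refine Finset.sum_le_sum_of_subset_of_nonneg ?_
      fun _ _ _ => ArithmeticFunction.vonMangoldt_nonneg
    intro y hy
    obtain ⟨⟨a, d, b⟩, h, rfl⟩ := Finset.mem_image.1 hy
    simp only [Finset.mem_sigma, Nat.mem_divisorsAntidiagonal, hA, mem_almostPrimesUpTo] at h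
    obtain ⟨⟨⟨-, haN⟩, har⟩, rfl, hab⟩ := h
    have hd0 : d ≠ 0 := left_ne_zero_of_mul hab
    have hb0 : b ≠ 0 := right_ne_zero_of_mul hab
    rw [ArithmeticFunction.cardFactors_mul hd0 hb0] at har
    simp only [e, Finset.mem_sigma, Finset.mem_Ioc, hA, mem_almostPrimesUpTo]
    refine ⟨⟨⟨Nat.pos_of_ne_zero hb0, ?_⟩, by omega⟩, Nat.pos_of_ne_zero hd0, ?_⟩
    · exact (Nat.le_mul_of_pos_left b (Nat.pos_of_ne_zero hd0)).trans haN
    · exact (Nat.le_div_iff_mul_le (Nat.pos_of_ne_zero hb0)).2 haN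
  have hpsi : ∀ b ∈ A, Chebyshev.psi (N / b : ℕ) ≤ (Real.log 4 + 4) * (N * (b : ℝ)⁻¹) := by
    intro b _
    have hl : 0 ≤ Real.log 4 := Real.log_nonneg (by norm_num)
    refine (Chebyshev.psi_le_const_mul_self (by positivity)).trans ?_
    gcongr
    rw [← div_eq_mul_inv]
    exact Nat.cast_div_le
  -- From `log (N / a) ≤ N / a`; this raises the constant from `log 4 + 4` to `log 4 + 5`.
  have hN : ∀ a ∈ A, Real.log N ≤ Real.log a + N * (a : ℝ)⁻¹ := by
    intro a ha
    rw [hA, mem_almostPrimesUpTo] at ha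
    have ha0 : (0 : ℝ) < a := by exact_mod_cast ha.1.1
    have hN0 : (0 : ℝ) < N := by exact_mod_cast ha.1.1.trans ha.1.2
    have := Real.log_le_self (x := N / a) (by positivity)
    rw [Real.log_div hN0.ne' ha0.ne', div_eq_mul_inv] at this
    linarith
  calc A.card * Real.log N = ∑ a ∈ A, Real.log N := by simp
    _ ≤ ∑ a ∈ A, (Real.log a + N * (a : ℝ)⁻¹) := Finset.sum_le_sum hN
    _ ≤ ∑ b ∈ A, (Real.log 4 + 4) * (N * (b : ℝ)⁻¹) + ∑ a ∈ A, N * (a : ℝ)⁻¹ := by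
        rw [Finset.sum_add_distrib]
        exact add_le_add (hlog.trans (Finset.sum_le_sum hpsi)) le_rfl
    _ = _ := by
        simp only [← Finset.mul_sum]
        ring

/-- Chebyshev's bound on `θ` shows that the primes in the dyadic block `(2 ^ (J + 1), 2 ^ (J + 2)]`
contribute at most `4 / (J + 1)`. -/
lemma sum_inv_primesLE_two_pow_le (J : ℕ) :
    ∑ p ∈ Nat.primesLE (2 ^ (J + 1)), (p : ℝ)⁻¹ ≤ 1 / 2 + 4 * harmonic J := by
  induction J with
  | zero =>
    have : Nat.primesLE (2 ^ (0 + 1)) = {2} := by decide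
    rw [this]
    norm_num
  | succ J ih =>
    have hlog2 : 0 < Real.log 2 := Real.log_pos one_lt_two
    have hsub : Nat.primesLE (2 ^ (J + 1)) ⊆ Nat.primesLE (2 ^ (J + 1 + 1)) := by
      intro p hp
      rw [Nat.mem_primesLE] at hp ⊢
      exact ⟨hp.1.trans (Nat.pow_le_pow_right two_pos (by omega)), hp.2⟩
    rw [← Finset.sum_sdiff hsub, harmonic_succ]
    have key : ∑ p ∈ Nat.primesLE (2 ^ (J + 1 + 1)) \ Nat.primesLE (2 ^ (J + 1)), (p : ℝ)⁻¹
        ≤ 4 * ((J : ℝ) + 1)⁻¹ := by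
      have hθ : ∑ p ∈ Nat.primesLE (2 ^ (J + 1 + 1)) \ Nat.primesLE (2 ^ (J + 1)), Real.log p
          ≤ Real.log 4 * 2 ^ (J + 1 + 1) := by
        have h := Chebyshev.theta_le_log4_mul_x (x := ((2 ^ (J + 1 + 1) : ℕ) : ℝ)) (by positivity)
        rw [Chebyshev.theta_eq_sum_primesLE_log] at h
        push_cast at h
        refine (Finset.sum_le_sum_of_subset_of_nonneg Finset.sdiff_subset ?_).trans h
        exact fun p _ _ => Real.log_natCast_nonneg p
      have hterm : ∀ p ∈ Nat.primesLE (2 ^ (J + 1 + 1)) \ Nat.primesLE (2 ^ (J + 1)),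
          (p : ℝ)⁻¹ ≤ Real.log p * (2 ^ (J + 1) * (((J : ℝ) + 1) * Real.log 2))⁻¹ := by
        intro p hp
        rw [Finset.mem_sdiff, Nat.mem_primesLE, Nat.mem_primesLE] at hp
        have hlt : 2 ^ (J + 1) < p := by
          by_contra! hle
          exact hp.2 ⟨hle, hp.1.2⟩
        have hlt' : (2 : ℝ) ^ (J + 1) ≤ p := by exact_mod_cast hlt.le
        have hlogp : ((J : ℝ) + 1) * Real.log 2 ≤ Real.log p := by
          have := Real.log_le_log (by positivity) hlt'
          rw [Real.log_pow] at this
          exact_mod_cast this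
        have hJ : 0 < ((J : ℝ) + 1) * Real.log 2 := by positivity
        calc (p : ℝ)⁻¹ ≤ (2 ^ (J + 1))⁻¹ := by gcongr
          _ = (((J : ℝ) + 1) * Real.log 2) * (2 ^ (J + 1) * (((J : ℝ) + 1) * Real.log 2))⁻¹ := by
              field_simp
          _ ≤ _ := by gcongr
      refine (Finset.sum_le_sum hterm).trans ?_
      rw [← Finset.sum_mul]
      refine (mul_le_mul_of_nonneg_right hθ (by positivity)).trans (le_of_eq ?_)
      rw [show (4 : ℝ) = 2 ^ 2 by norm_num, Real.log_pow]
      field_simp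
      push_cast
      ring
    push_cast
    linarith

/-! ### Densities of almost primes and primes up to `C ^ n` -/

lemma floor_pow_pos {C : ℝ} (hC : 1 < C) (n : ℕ) : 0 < ⌊C ^ n⌋₊ :=
  Nat.floor_pos.2 (one_le_pow₀ hC.le)

lemma log_floor_pow_le {C : ℝ} (hC : 1 < C) (n : ℕ) : Real.log ⌊C ^ n⌋₊ ≤ n * Real.log C := by
  rw [← Real.log_pow]
  exact Real.log_le_log (by exact_mod_cast floor_pow_pos hC n) (Nat.floor_le (by positivity))

lemma eventually_le_log_floor_pow {C : ℝ} (hC : 1 < C) :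
    ∀ᶠ n : ℕ in Filter.atTop, Real.log C / 2 * n ≤ Real.log ⌊C ^ n⌋₊ := by
  have hlogC := Real.log_pos hC
  have hn := tendsto_natCast_atTop_atTop (R := ℝ) |>.eventually_ge_atTop (2 * Real.log 2 / Real.log C)
  filter_upwards [hn] with n hn
  have hN : (1 : ℝ) ≤ ⌊C ^ n⌋₊ := by exact_mod_cast floor_pow_pos hC n
  have hlt := Nat.lt_floor_add_one (C ^ n)
  have h2 : C ^ n ≤ 2 * ⌊C ^ n⌋₊ := by linarith
  have := Real.log_le_log (by positivity) h2
  rw [Real.log_pow, Real.log_mul two_ne_zero (by positivity)] at this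
  rw [div_le_iff₀ hlogC] at hn
  linarith

/-- The density of the almost primes up to `C ^ n` is at most a constant times `n ^ (-3 / 4)`. -/
lemma exists_eventually_almostPrimes_density_le {C : ℝ} (hC : 1 < C) (r : ℕ) :
    ∃ K : ℝ, ∀ᶠ n : ℕ in Filter.atTop,
      ((almostPrimesUpTo r ⌊C ^ n⌋₊).card : ℝ) / ⌊C ^ n⌋₊ ≤ K * (n : ℝ) ^ (-(3 / 4) : ℝ) := by
  have hlogC := Real.log_pos hC
  have hlog4 : 0 ≤ Real.log 4 := Real.log_nonneg (by norm_num)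
  obtain ⟨L, hL⟩ := pow_unbounded_of_one_lt C one_lt_two
  have hL0 : L ≠ 0 := by
    rintro rfl
    norm_num at hL
    linarith
  have hLpos : (0 : ℝ) < L := by exact_mod_cast Nat.pos_of_ne_zero hL0
  refine ⟨(Real.log 4 + 5) * 5 ^ r / (Real.log C / 2), ?_⟩
  -- This threshold turns `1 + 1/2 + 4 * (1 + log L + log n)` into at most `5 * log n`.
  have hlogn := (Real.tendsto_log_atTop.comp (tendsto_natCast_atTop_atTop (R := ℝ))).eventually_ge_atTop
    (6 + 4 * Real.log L)
  -- Any exponent below `1/2` would leave the squared density summable.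
  have hlogr := ((isLittleO_log_rpow_rpow_atTop (r : ℝ) (show (0 : ℝ) < 1 / 4 by norm_num)).bound
    one_pos).natCast_atTop
  filter_upwards [hlogn, hlogr, eventually_le_log_floor_pow hC, Filter.eventually_ge_atTop 1]
    with n hlogn hlogr hlogN hn1
  simp only [Function.comp_apply] at hlogn
  have hn0 : (0 : ℝ) < n := by exact_mod_cast hn1
  have hlogn0 : 0 ≤ Real.log n := Real.log_nonneg (by exact_mod_cast hn1)
  rw [Real.rpow_natCast, one_mul, Real.norm_of_nonneg (by positivity),
    Real.norm_of_nonneg (by positivity)] at hlogr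
  set N := ⌊C ^ n⌋₊ with hN
  have hN0 : (0 : ℝ) < N := by exact_mod_cast floor_pow_pos hC n
  have hNle : N ≤ 2 ^ (L * n + 1) := by
    have : (N : ℝ) ≤ 2 ^ (L * n + 1) := by
      calc (N : ℝ) ≤ C ^ n := Nat.floor_le (by positivity)
        _ ≤ (2 ^ L) ^ n := by gcongr
        _ = 2 ^ (L * n) := (pow_mul _ _ _).symm
        _ ≤ 2 ^ (L * n + 1) := pow_le_pow_right₀ one_le_two (by omega)
    exact_mod_cast this
  have hS : ∑ a ∈ almostPrimesUpTo r N, (a : ℝ)⁻¹ ≤ 5 ^ r * (n : ℝ) ^ (1 / 4 : ℝ) := by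
    calc ∑ a ∈ almostPrimesUpTo r N, (a : ℝ)⁻¹
        ≤ ∑ a ∈ almostPrimesUpTo r (2 ^ (L * n + 1)), (a : ℝ)⁻¹ :=
          Finset.sum_le_sum_of_subset_of_nonneg (almostPrimesUpTo_mono hNle)
            fun _ _ _ => by positivity
      _ ≤ (1 + ∑ p ∈ Nat.primesLE (2 ^ (L * n + 1)), (p : ℝ)⁻¹) ^ r :=
          sum_inv_almostPrimesUpTo_le _ _
      _ ≤ (5 * Real.log n) ^ r := by
          have h1 := sum_inv_primesLE_two_pow_le (L * n)
          have h2 := harmonic_le_one_add_log (L * n)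
          push_cast at h2
          rw [Real.log_mul hLpos.ne' hn0.ne'] at h2
          have h0 : 0 ≤ ∑ p ∈ Nat.primesLE (2 ^ (L * n + 1)), (p : ℝ)⁻¹ :=
            Finset.sum_nonneg fun _ _ => by positivity
          gcongr
          linarith
      _ = 5 ^ r * Real.log n ^ r := mul_pow _ _ _
      _ ≤ _ := by gcongr
  have hmain := card_almostPrimesUpTo_mul_log_le r N
  have hn34 : (n : ℝ) ^ (-(3 / 4) : ℝ) * n = (n : ℝ) ^ (1 / 4 : ℝ) := by
    rw [← Real.rpow_add_one hn0.ne']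
    norm_num
  have hlogN0 : 0 < Real.log C / 2 * n := by positivity
  rw [div_le_iff₀ hN0]
  refine le_of_mul_le_mul_right ?_ hlogN0
  calc ((almostPrimesUpTo r N).card : ℝ) * (Real.log C / 2 * n)
      ≤ (almostPrimesUpTo r N).card * Real.log N := by gcongr
    _ ≤ (Real.log 4 + 5) * N * ∑ a ∈ almostPrimesUpTo r N, (a : ℝ)⁻¹ := hmain
    _ ≤ (Real.log 4 + 5) * N * (5 ^ r * (n : ℝ) ^ (1 / 4 : ℝ)) := by gcongr
    _ = _ := by
        rw [← hn34]
        field_simp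

lemma summable_almostPrimes_density_sq {C : ℝ} (hC : 1 < C) (r : ℕ) :
    Summable fun n : ℕ => (((almostPrimesUpTo r ⌊C ^ n⌋₊).card : ℝ) / ⌊C ^ n⌋₊) ^ 2 := by
  obtain ⟨K, hK⟩ := exists_eventually_almostPrimes_density_le hC r
  have hs : Summable fun n : ℕ => K ^ 2 * (n : ℝ) ^ (-(3 / 2) : ℝ) :=
    (Real.summable_nat_rpow.2 (by norm_num)).mul_left _
  refine Summable.of_norm_bounded_eventually_nat hs ?_
  filter_upwards [hK] with n hn
  rw [Real.norm_of_nonneg (by positivity)]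
  refine (pow_le_pow_left₀ (by positivity) hn 2).trans (le_of_eq ?_)
  rw [mul_pow, ← Real.rpow_natCast ((n : ℝ) ^ _), ← Real.rpow_mul (by positivity)]
  norm_num

/-- The density of the primes up to `C ^ n` is at least a constant times `1 / n`. -/
lemma eventually_le_primes_density {C : ℝ} (hC : 1 < C) :
    ∀ᶠ n : ℕ in Filter.atTop,
      (2 * Real.log C)⁻¹ / n ≤ ((⌊C ^ n⌋₊.primesLE.card : ℕ) : ℝ) / ⌊C ^ n⌋₊ := by
  have hlogC := Real.log_pos hC
  have hN : Filter.Tendsto (fun n : ℕ => ((⌊C ^ n⌋₊ + 1 : ℕ) : ℝ)) Filter.atTop Filter.atTop :=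
    tendsto_natCast_atTop_atTop.comp ((Filter.tendsto_add_atTop_nat 1).comp
      (tendsto_nat_floor_atTop.comp (tendsto_pow_atTop_atTop_of_one_lt hC)))
  -- With `1/20`, the loss `log (N + 1)` stays below `(log 2 - 1/2) * N`.
  have hlog := hN.eventually (Real.isLittleO_log_id_atTop.bound (show (0 : ℝ) < 1 / 20 by norm_num))
  filter_upwards [hlog, hN.eventually_ge_atTop 3, Filter.eventually_ge_atTop 1] with n hlog hN3 hn1
  have hn0 : (0 : ℝ) < n := by exact_mod_cast hn1
  set N := ⌊C ^ n⌋₊ with hNdef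
  push_cast at hN3 hlog
  rw [id, Real.norm_of_nonneg (Real.log_nonneg (by linarith)), Real.norm_of_nonneg (by linarith)]
    at hlog
  have hN0 : (0 : ℝ) < N := by linarith
  have hlogN : 0 < Real.log N := Real.log_pos (by linarith)
  have hpi := Chebyshev.pi_ge N
  rw [← Nat.primesLE_card_eq_primeCounting, div_le_iff₀ hlogN] at hpi
  have hhalf : (N : ℝ) / 2 ≤ N.primesLE.card * Real.log N := by
    nlinarith [Real.log_two_gt_d9]
  have hle : Real.log N ≤ n * Real.log C := log_floor_pow_le hC n
  have hhalf' : (N : ℝ) / 2 ≤ N.primesLE.card * (n * Real.log C) := hhalf.trans (by gcongr)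
  rw [div_le_div_iff₀ hn0 hN0, inv_mul_le_iff₀ (by positivity)]
  linarith

/-! ### Divergent integrals and series -/

/-- If the events `A n` are pairwise independent and `∑ P (A n) < ∞`, then for all but finitely many
`n` at least half of `A n` lies outside all later events; hence a function which is at least `g n`
on `A n` has infinite integral as soon as `∑ g n * P (A n) = ∞`. -/
lemma lintegral_eq_top_of_tsum_mul_measure_eq_top {Ω : Type*} [MeasurableSpace Ω] {P : Measure Ω}
    [IsProbabilityMeasure P] {A : ℕ → Set Ω} (hA : ∀ n, NullMeasurableSet (A n) P)
    (hind : ∀ i j, i ≠ j → P (A i ∩ A j) = P (A i) * P (A j))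
    (hsum : ∑' n, P (A n) ≠ ∞) {g : ℕ → ℝ≥0∞} (hg : ∀ n, g n ≠ ∞)
    (hgA : ∑' n, g n * P (A n) = ∞) {f : Ω → ℝ≥0∞}
    (hf : ∀ n, ∀ ω ∈ A n, g n ≤ f ω) :
    ∫⁻ ω, f ω ∂P = ∞ := by
  let E : ℕ → Set Ω := fun n => A n \ ⋃ i, A (i + (n + 1))
  have hmem : ∀ n ω, ω ∈ E n ↔ ω ∈ A n ∧ ∀ i, n < i → ω ∉ A i := by
    intro n ω
    simp only [E, Set.mem_sdiff, Set.mem_iUnion, not_exists]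
    refine and_congr_right fun _ => ⟨fun h i hi => ?_, fun h i => h _ (by omega)⟩
    have := h (i - (n + 1))
    rwa [Nat.sub_add_cancel hi] at this
  have hE : ∀ n, NullMeasurableSet (E n) P :=
    fun n => (hA n).diff (NullMeasurableSet.iUnion fun i => hA _)
  have hdisj : Pairwise (Function.onFun (AEDisjoint P) E) := by
    have : Pairwise (Function.onFun Disjoint E) := by
      rw [pairwise_disjoint_on]
      intro m n hmn
      rw [Set.disjoint_left]
      intro ω hm hn
      exact ((hmem m ω).1 hm).2 n hmn ((hmem n ω).1 hn).1
    exact fun i j hij => (this hij).aedisjoint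
  have hint : ∑' n, g n * P (E n) ≤ ∫⁻ ω, f ω ∂P := by
    calc ∑' n, g n * P (E n) ≤ ∑' n, ∫⁻ ω in E n, f ω ∂P := by
          refine ENNReal.tsum_le_tsum fun n => ?_
          rw [← setLIntegral_const]
          refine lintegral_mono_ae ?_
          filter_upwards [ae_restrict_mem₀ (hE n)] with ω hω
          exact hf n ω hω.1
      _ = ∫⁻ ω in ⋃ n, E n, f ω ∂P := (lintegral_iUnion₀ hE hdisj f).symm
      _ ≤ _ := setLIntegral_le_lintegral _ _
  obtain ⟨N, hN⟩ := ((ENNReal.tendsto_sum_nat_add (fun n => P (A n)) hsum).eventually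
    (ge_mem_nhds (show (0 : ℝ≥0∞) < 2⁻¹ by simp))).exists_forall_of_atTop
  have hhalf : ∀ n, N ≤ n → P (A n) ≤ 2 * P (E n) := by
    intro n hn
    have hlater : P (A n ∩ ⋃ i, A (i + (n + 1))) ≤ P (A n) * 2⁻¹ := by
      rw [Set.inter_iUnion]
      calc P (⋃ i, A n ∩ A (i + (n + 1))) ≤ ∑' i, P (A n ∩ A (i + (n + 1))) :=
            measure_iUnion_le _
        _ = ∑' i, P (A n) * P (A (i + (n + 1))) := by
            congr with i
            exact hind _ _ (by omega)
        _ = P (A n) * ∑' i, P (A (i + (n + 1))) := ENNReal.tsum_mul_left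
        _ ≤ _ := by
            gcongr
            exact hN (n + 1) (by omega)
    have hsplit : P (A n) ≤ P (A n) * 2⁻¹ + P (E n) :=
      (measure_le_inter_add_sdiff P (A n) _).trans (by gcongr)
    have hfin : P (A n) * 2⁻¹ ≠ ∞ := ENNReal.mul_ne_top (measure_ne_top _ _) (by simp)
    have h2 : P (A n) = P (A n) * 2⁻¹ + P (A n) * 2⁻¹ := by
      rw [← mul_add, ENNReal.inv_two_add_inv_two, mul_one]
    have hle : P (A n) * 2⁻¹ ≤ P (E n) := by
      refine (ENNReal.add_le_add_iff_left hfin).1 ?_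
      exact h2.symm.le.trans hsplit
    calc P (A n) = P (A n) * 2⁻¹ + P (A n) * 2⁻¹ := h2
      _ ≤ P (E n) + P (E n) := add_le_add hle hle
      _ = 2 * P (E n) := (two_mul _).symm
  -- The discarded initial terms are finite.
  have htail : ∑' n, g (n + N) * P (A (n + N)) = ∞ := by
    have hadd := ENNReal.summable.sum_add_tsum_nat_add' (f := fun n => g n * P (A n)) (k := N)
    rw [hgA, ENNReal.add_eq_top] at hadd
    refine hadd.resolve_left (ENNReal.sum_ne_top.2 fun n _ => ?_)
    exact ENNReal.mul_ne_top (hg n) (measure_ne_top _ _)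
  have hle : ∑' n, g (n + N) * P (A (n + N)) ≤ 2 * ∫⁻ ω, f ω ∂P := by
    calc ∑' n, g (n + N) * P (A (n + N)) ≤ ∑' n, 2 * (g (n + N) * P (E (n + N))) := by
          refine ENNReal.tsum_le_tsum fun n => ?_
          rw [mul_left_comm]
          gcongr
          exact hhalf _ (by omega)
      _ = 2 * ∑' n, g (n + N) * P (E (n + N)) := ENNReal.tsum_mul_left
      _ ≤ 2 * ∑' n, g n * P (E n) := by
          refine mul_le_mul_right ?_ 2
          exact ENNReal.tsum_comp_le_tsum_of_injective (add_left_injective N)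
            fun n => g n * P (E n)
      _ ≤ _ := by gcongr
  rw [htail, top_le_iff] at hle
  by_contra h
  exact ENNReal.mul_ne_top (by simp) h hle

/-- A nonnegative sequence bounded below by a multiple of the harmonic series has infinite sum. -/
lemma ENNReal.tsum_eq_top_of_eventually_div_le {u : ℕ → ℝ≥0∞} {c : ℝ} (hc : 0 < c)
    (hu : ∀ᶠ n : ℕ in Filter.atTop, ENNReal.ofReal (c / (n + 1)) ≤ u n) : ∑' n, u n = ∞ := by
  by_contra h
  have hs := ENNReal.summable_toReal h
  have hs' : Summable fun n : ℕ => c / ((n : ℝ) + 1) := by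
    refine Summable.of_norm_bounded_eventually_nat hs ?_
    filter_upwards [hu] with n hn
    rw [Real.norm_of_nonneg (by positivity)]
    exact (ENNReal.ofReal_le_iff_le_toReal (ENNReal.ne_top_of_tsum_ne_top h n)).1 hn
  have h1 : Summable fun n : ℕ => 1 / ((n : ℝ) + 1) := by
    have := hs'.mul_left c⁻¹
    refine this.congr fun n => ?_
    field_simp
  have h2 : Summable fun n : ℕ => 1 / (n : ℝ) := by
    rw [← summable_nat_add_iff 1]
    simpa using h1
  exact Real.not_summable_one_div_natCast h2

/-! ### Probability of an almost prime product -/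

lemma drawBox_eq_piFinset (k : ℕ) {C : ℝ} (hC : 1 < C) (n : ℕ+) :
    drawBox k C n = (Fintype.piFinset fun _ : Fin k => Finset.Icc 1 ⌊C ^ (n : ℕ)⌋₊ : Finset _) := by
  ext v
  have : 0 ≤ C ^ (n : ℕ) := by positivity
  simp [drawBox, Nat.le_floor_iff this, Pi.le_def, forall_and]

lemma uniformOn_piFinset_const (k : ℕ) {s t : Finset ℕ} (hs : s.Nonempty) (hts : t ⊆ s) :
    uniformOn (Fintype.piFinset fun _ : Fin k => s : Set (Fin k → ℕ))
      (Fintype.piFinset fun _ : Fin k => t : Finset (Fin k → ℕ)) =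
      ENNReal.ofReal ((t.card / s.card : ℝ) ^ k) := by
  have hs0 : (0 : ℝ) < s.card := by exact_mod_cast hs.card_pos
  rw [uniformOn_apply_finset,
    Finset.inter_eq_right.2 (Fintype.piFinset_subset _ _ fun _ => hts), Fintype.card_piFinset_const,
    Fintype.card_piFinset_const, div_pow, ENNReal.ofReal_div_of_pos (by positivity)]
  norm_cast

lemma uniformOn_drawBox_le (k : ℕ) {C : ℝ} (hC : 1 < C) (n : ℕ+) (R : ℝ) :
    uniformOn (drawBox k C n) {v | (ArithmeticFunction.cardFactors (∏ j, v j) : ℝ) ≤ R} ≤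
      ENNReal.ofReal (((almostPrimesUpTo ⌊R⌋₊ ⌊C ^ (n : ℕ)⌋₊).card / ⌊C ^ (n : ℕ)⌋₊ : ℝ) ^ k) := by
  have hne : (Finset.Icc 1 ⌊C ^ (n : ℕ)⌋₊).Nonempty := Finset.nonempty_Icc.2 (floor_pow_pos hC n)
  have h := uniformOn_piFinset_const k hne (t := almostPrimesUpTo ⌊R⌋₊ ⌊C ^ (n : ℕ)⌋₊)
    (Finset.filter_subset _ _)
  rw [Nat.card_Icc, Nat.add_sub_cancel] at h
  -- Intersecting with the box makes all entries nonzero, as additivity of `cardFactors` requires.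
  rw [drawBox_eq_piFinset k hC, ← h, ← uniformOn_inter_self (Finset.finite_toSet _)]
  refine measure_mono ?_
  rintro v ⟨hv, hvR⟩
  rw [Finset.mem_coe, Fintype.mem_piFinset] at hv ⊢
  simp only [Finset.mem_Icc] at hv
  intro j
  refine mem_almostPrimesUpTo.2 ⟨hv j, (le_trans ?_ (Nat.le_floor hvR))⟩
  have h0 : ∀ i, v i ≠ 0 := fun i => Nat.one_le_iff_ne_zero.1 (hv i).1
  rw [← Finset.mul_prod_erase _ _ (Finset.mem_univ j),
    ArithmeticFunction.cardFactors_mul (h0 j) (Finset.prod_ne_zero_iff.2 fun i _ => h0 i)]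
  exact Nat.le_add_right _ _

lemma le_uniformOn_drawBox (k : ℕ) {C : ℝ} (hC : 1 < C) (n : ℕ+) {R : ℝ} (hR : (k : ℝ) ≤ R) :
    ENNReal.ofReal ((⌊C ^ (n : ℕ)⌋₊.primesLE.card / ⌊C ^ (n : ℕ)⌋₊ : ℝ) ^ k) ≤
      uniformOn (drawBox k C n) {v | (ArithmeticFunction.cardFactors (∏ j, v j) : ℝ) ≤ R} := by
  have hne : (Finset.Icc 1 ⌊C ^ (n : ℕ)⌋₊).Nonempty := Finset.nonempty_Icc.2 (floor_pow_pos hC n)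
  have h := uniformOn_piFinset_const k hne (t := ⌊C ^ (n : ℕ)⌋₊.primesLE) (fun p hp => by
    rw [Nat.mem_primesLE] at hp
    exact Finset.mem_Icc.2 ⟨hp.2.one_lt.le, hp.1⟩)
  rw [Nat.card_Icc, Nat.add_sub_cancel] at h
  rw [drawBox_eq_piFinset k hC, ← h]
  refine measure_mono fun v hv => ?_
  rw [Finset.mem_coe, Fintype.mem_piFinset] at hv
  have hp : ∀ j, (v j).Prime := fun j => (Nat.mem_primesLE.1 (hv j)).2
  have hΩ : ArithmeticFunction.cardFactors (∏ j, v j) = k := by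
    have : ∏ j, v j = ((Finset.univ : Finset (Fin k)).val.map v).prod := rfl
    rw [this, ArithmeticFunction.cardFactors_multiset_prod, Multiset.map_map]
    · have h1 : ∀ j, (ArithmeticFunction.cardFactors ∘ v) j = 1 :=
        fun j => ArithmeticFunction.cardFactors_apply_prime (hp j)
      rw [Multiset.map_congr rfl fun j _ => h1 j]
      simp
    · exact Finset.prod_ne_zero_iff.2 fun j _ => (hp j).ne_zero
  rw [Set.mem_ofPred_eq, hΩ]
  exact hR

/-! ### The last almost prime index -/

lemma lastAlmostPrimeIndex_lt_top {k : ℕ} {R : ℝ} {x : ℕ+ → Fin k → ℕ}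
    (h : ∀ᶠ n : ℕ in Filter.atTop, n.succPNat ∉ almostPrimeIndices R x) :
    lastAlmostPrimeIndex R x < ⊤ := by
  obtain ⟨N, hN⟩ := h.exists_forall_of_atTop
  refine lt_of_le_of_lt (iSup₂_le fun n hn => ?_) (ENat.natCast_lt_top N)
  rw [Nat.cast_le]
  by_contra! hlt
  refine hN n.natPred ?_ ?_
  · have := n.natPred_add_one
    omega
  · rwa [PNat.succPNat_natPred]

theorem mainTheorem3 {Ω : Type*} [MeasurableSpace Ω] (P : Measure Ω) [IsProbabilityMeasure P]
    (k : ℕ) (hk : 2 ≤ k) (C : ℝ) (hC : 1 < C) (R : ℝ) (hR : (k : ℝ) ≤ R)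
    (X : ℕ+ → Ω → (Fin k → ℕ))
    (hX : ∀ n, HasLaw (X n) (uniformOn (drawBox k C n)) P)
    (hindep : iIndepFun X P) :
    (∀ᵐ ω ∂P, lastAlmostPrimeIndex R (fun n => X n ω) < ⊤) ∧
      ∀ m : ℝ, (k : ℝ) - 1 ≤ m →
        ∫⁻ ω, ((lastAlmostPrimeIndex R (fun n => X n ω) : ℕ∞) : ℝ≥0∞) ^ m ∂P = ∞ := by
  let T : Set (Fin k → ℕ) := {v | (ArithmeticFunction.cardFactors (∏ j, v j) : ℝ) ≤ R}
  have hT : MeasurableSet T := T.to_countable.measurableSet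
  -- `A n` concerns the draw of index `n + 1`.
  let A : ℕ → Set Ω := fun n => X n.succPNat ⁻¹' T
  have hPA : ∀ n, P (A n) = uniformOn (drawBox k C n.succPNat) T := by
    intro n
    rw [← (hX n.succPNat).map_eq, Measure.map_apply_of_aemeasurable (hX _).aemeasurable hT]
  have hA : ∀ n, NullMeasurableSet (A n) P :=
    fun n => (hX n.succPNat).aemeasurable.nullMeasurable hT
  have hind : ∀ i j, i ≠ j → P (A i ∩ A j) = P (A i) * P (A j) := fun i j hij =>
    (hindep.indepFun (Nat.succPNat_injective.ne hij)).measure_inter_preimage_eq_mul _ _ hT hT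
  have hsum : ∑' n, P (A n) ≠ ∞ := by
    have hs := (summable_nat_add_iff 1).2 (summable_almostPrimes_density_sq hC ⌊R⌋₊)
    refine ne_top_of_le_ne_top hs.tsum_ofReal_ne_top (ENNReal.tsum_le_tsum fun n => ?_)
    rw [hPA]
    refine (uniformOn_drawBox_le k hC _ R).trans (ENNReal.ofReal_le_ofReal ?_)
    -- A density is at most `1`, so its `k`-th power is at most its square.
    refine pow_le_pow_of_le_one (by positivity) (div_le_one_of_le₀ ?_ (by positivity)) hk
    have := Finset.card_filter_le (Finset.Icc 1 ⌊C ^ (n + 1)⌋₊)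
      fun a => ArithmeticFunction.cardFactors a ≤ ⌊R⌋₊
    rw [Nat.card_Icc, Nat.add_sub_cancel] at this
    exact_mod_cast this
  refine ⟨?_, fun m hm => ?_⟩
  · filter_upwards [ae_eventually_notMem hsum] with ω hω
    exact lastAlmostPrimeIndex_lt_top hω
  have hk1 : ((k - 1 : ℕ) : ℝ) = k - 1 := by
    rw [Nat.cast_sub (by omega), Nat.cast_one]
  have hm0 : 0 ≤ m := by
    refine le_trans ?_ hm
    rw [← hk1]
    positivity
  refine lintegral_eq_top_of_tsum_mul_measure_eq_top hA hind hsum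
    (g := fun n => ENNReal.ofReal (((n : ℝ) + 1) ^ (k - 1))) (fun _ => ENNReal.ofReal_ne_top) ?_ ?_
  · have hlogC := Real.log_pos hC
    refine ENNReal.tsum_eq_top_of_eventually_div_le (c := (2 * Real.log C)⁻¹ ^ k) (by positivity) ?_
    filter_upwards [(Filter.tendsto_add_atTop_nat 1).eventually (eventually_le_primes_density hC)]
      with n hn
    have hle := (ENNReal.ofReal_le_ofReal (pow_le_pow_left₀ (by positivity) hn k)).trans
      (le_uniformOn_drawBox k hC n.succPNat hR)
    rw [hPA]
    refine le_trans (le_of_eq ?_) (mul_le_mul_right hle _)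
    rw [← ENNReal.ofReal_mul (by positivity)]
    congr 1
    push_cast
    -- The weight `(n + 1) ^ (k - 1)` cancels all but one power of `n + 1`.
    obtain ⟨l, rfl⟩ : ∃ l, k = l + 1 := ⟨k - 1, by omega⟩
    rw [Nat.add_sub_cancel, div_pow, pow_succ ((n : ℝ) + 1)]
    field_simp
  · intro n ω hω
    have hle : ((n + 1 : ℕ) : ℕ∞) ≤ lastAlmostPrimeIndex R fun n => X n ω :=
      le_iSup₂_of_le n.succPNat hω le_rfl
    have hle' : ((n + 1 : ℕ) : ℝ≥0∞) ≤ (lastAlmostPrimeIndex R fun n => X n ω : ℕ∞) := by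
      rw [← ENat.toENNReal_coe]
      exact ENat.toENNReal_mono hle
    refine le_trans ?_ (ENNReal.rpow_le_rpow hle' hm0)
    rw [← ENNReal.ofReal_natCast, ENNReal.ofReal_rpow_of_nonneg (by positivity) hm0]
    refine ENNReal.ofReal_le_ofReal ?_
    push_cast
    rw [← Real.rpow_natCast, hk1]
    exact Real.rpow_le_rpow_of_exponent_le (by linarith [n.cast_nonneg (α := ℝ)]) hm
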